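/- Let $(V,g)$ be a finite-dimensional real vector space with a positive definite inner product. An algebraic curvature tensor on $V$ is a 4-linear form $R\colon V^4\to\mathbb{R}$ such that, for all $X,Y,Z,W\in V$, $$R(X,Y,Z,W)=-R(Y,X,Z,W)=-R(X,Y,W,Z)=R(Z,W,X,Y),$$ $$R(X,Y,Z,W)+R(Y,Z,X,W)+R(Z,X,Y,W)=0.$$ Let $\mathcal{R}(X,Y)Z$ be the vector determined by $g(\mathcal{R}(X,Y)Z,W)=R(X,Y,Z,W)$ for all $W$, and for $X\in V$ let $\mathcal{J}_X\colon V\to V$, $\mathcal{J}_XY=\mathcal{R}(Y,X)X$, be the Jacobi operator. It maps $X^\perp$ into itself; its restriction $\widetilde{\mathcal{J}}_X\colon X^\perp\to X^\perp$ is the reduced Jacobi operator. Call $R$ Jacobi-orthogonal if $g(\mathcal{J}_XY,\mathcal{J}_YX)=0$ for all $X,Y\in V$ with $g(X,Y)=0$, and Osserman if the characteristic polynomial $\det(\lambda\,\mathrm{Id}-\widetilde{\mathcal{J}}_X)$ is the same for all unit vectors $X\in V$. Then every Jacobi-orthogonal algebraic curvature tensor is Osserman. -/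

import Mathlib

/-- An algebraic curvature tensor on a real inner product space: a covariant 4-tensor `R` with the
usual curvature symmetries and the first Bianchi identity. -/
structure AlgCurvatureTensor (V : Type*) [NormedAddCommGroup V] [InnerProductSpace ℝ V] where
  /-- The underlying 4-linear form `R(X, Y, Z, W)`. -/
  form : V →ₗ[ℝ] V →ₗ[ℝ] V →ₗ[ℝ] V →ₗ[ℝ] ℝ
  skew_left : ∀ X Y Z W : V, form X Y Z W = - form Y X Z W
  skew_right : ∀ X Y Z W : V, form X Y Z W = - form X Y W Z
  pair_symm : ∀ X Y Z W : V, form X Y Z W = form Z W X Y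
  bianchi : ∀ X Y Z W : V, form X Y Z W + form Y Z X W + form Z X Y W = 0

namespace AlgCurvatureTensor

/-- Raising an index: the linear functional `φ` goes to the vector `v` with `⟪v, w⟫ = φ w`. -/
noncomputable def sharp {V : Type*} [NormedAddCommGroup V] [InnerProductSpace ℝ V]
    [FiniteDimensional ℝ V] : (V →ₗ[ℝ] ℝ) →ₗ[ℝ] V :=
  haveI : CompleteSpace V := FiniteDimensional.complete ℝ V
  ((LinearMap.toContinuousLinearMap (𝕜 := ℝ) (E := V) (F' := ℝ)).trans
    (InnerProductSpace.toDual ℝ V).symm.toLinearEquiv).toLinearMap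

theorem inner_sharp {V : Type*} [NormedAddCommGroup V] [InnerProductSpace ℝ V]
    [FiniteDimensional ℝ V] (φ : V →ₗ[ℝ] ℝ) (w : V) : inner ℝ (sharp φ) w = φ w := by
  have : CompleteSpace V := FiniteDimensional.complete ℝ V
  simp [sharp]

/-- The curvature operator `𝓡(X, Y) Z`, determined by `⟪𝓡(X, Y) Z, W⟫ = R(X, Y, Z, W)`. -/
noncomputable def curvatureOp {V : Type*} [NormedAddCommGroup V] [InnerProductSpace ℝ V]
    [FiniteDimensional ℝ V] (R : AlgCurvatureTensor V) (X Y : V) : V →ₗ[ℝ] V :=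
  sharp ∘ₗ R.form X Y

/-- The Jacobi operator `𝓙_X Y = 𝓡(Y, X) X`. -/
noncomputable def jacobi {V : Type*} [NormedAddCommGroup V] [InnerProductSpace ℝ V]
    [FiniteDimensional ℝ V] (R : AlgCurvatureTensor V) (X : V) : V →ₗ[ℝ] V where
  toFun Y := R.curvatureOp Y X X
  map_add' Y Z := by simp [curvatureOp]
  map_smul' c Y := by simp [curvatureOp]

theorem inner_jacobi {V : Type*} [NormedAddCommGroup V] [InnerProductSpace ℝ V]
    [FiniteDimensional ℝ V] (R : AlgCurvatureTensor V) (X Y W : V) :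
    inner ℝ (R.jacobi X Y) W = R.form Y X X W :=
  inner_sharp _ _

theorem jacobi_mem_orthogonal {V : Type*} [NormedAddCommGroup V] [InnerProductSpace ℝ V]
    [FiniteDimensional ℝ V] (R : AlgCurvatureTensor V) (X Y : V) :
    R.jacobi X Y ∈ (Submodule.span ℝ {X})ᗮ := by
  rw [Submodule.mem_orthogonal_singleton_iff_inner_left, inner_jacobi]
  linarith [R.skew_right Y X X X]

/-- The reduced Jacobi operator: the restriction of `𝓙_X` to the orthogonal complement of `X`. -/
noncomputable def reducedJacobi {V : Type*} [NormedAddCommGroup V] [InnerProductSpace ℝ V]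
    [FiniteDimensional ℝ V] (R : AlgCurvatureTensor V) (X : V) :
    (Submodule.span ℝ {X})ᗮ →ₗ[ℝ] (Submodule.span ℝ {X})ᗮ :=
  (R.jacobi X).restrict fun Y _ => R.jacobi_mem_orthogonal X Y

/-- `R` is Jacobi-orthogonal if `𝓙_X Y ⟂ 𝓙_Y X` whenever `X ⟂ Y`. -/
def IsJacobiOrthogonal {V : Type*} [NormedAddCommGroup V] [InnerProductSpace ℝ V]
    [FiniteDimensional ℝ V] (R : AlgCurvatureTensor V) : Prop :=
  ∀ X Y : V, inner ℝ X Y = 0 → inner ℝ (R.jacobi X Y) (R.jacobi Y X) = 0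

/-- `R` is Osserman if the characteristic polynomial of the reduced Jacobi operator is the same
for all unit vectors. -/
def IsOsserman {V : Type*} [NormedAddCommGroup V] [InnerProductSpace ℝ V]
    [FiniteDimensional ℝ V] (R : AlgCurvatureTensor V) : Prop :=
  ∀ X Y : V, ‖X‖ = 1 → ‖Y‖ = 1 → (R.reducedJacobi X).charpoly = (R.reducedJacobi Y).charpoly

end AlgCurvatureTensor

/-!
# Jacobi-orthogonal algebraic curvature tensors are Osserman

Applying Jacobi-orthogonality to the pair `X + Y`, `Y - X`, where `X ⟂ Y` and `‖X‖ = ‖Y‖`, gives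
`‖𝓙_X Y‖ = ‖𝓙_Y X‖` (`IsJacobiOrthogonal.norm_jacobi_comm`). If moreover `𝓙_X Y = μ Y`, then
`‖𝓙_Y X‖ = |μ| ‖X‖` while `⟪𝓙_Y X, X⟫ = ⟪𝓙_X Y, Y⟫ = μ ‖X‖²`, and the equality case of the
Cauchy–Schwarz inequality forces `𝓙_Y X = μ X`. This is Rakić's duality principle
(`IsJacobiOrthogonal.jacobi_eq_smul_of_norm_eq`).

By duality, `R(E, X, Y, E) = 0` whenever `X` is a unit vector, `E` is an eigenvector of `𝓙_X` and
`Y ⟂ X` (`IsJacobiOrthogonal.form_eigenvector_eq_zero`). Now let `X` move along a great circle with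
velocity `Y ⟂ X`. In an orthonormal eigenbasis `(Eᵢ)` of `𝓙_X`, the matrix of `lam - 𝓙_X` is
diagonal, and its derivative has diagonal entries `-2 R(Eᵢ, X, Y, Eᵢ) = 0`; hence the derivative of
`det (lam - 𝓙_X)` vanishes (`hasDerivAt_det_of_diagonal`). So the determinant is constant along
great circles, that is, on the unit sphere. Finally `det (lam - 𝓙_X)` equals `lam` times the value
at `lam` of the characteristic polynomial of the reduced Jacobi operator.
-/

/-- A curve of matrices that passes through a diagonal matrix with a velocity whose diagonal
vanishes has a determinant with vanishing derivative there. -/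
theorem hasDerivAt_det_of_diagonal {n : Type*} [Fintype n] [DecidableEq n]
    {M : ℝ → Matrix n n ℝ} {M' : Matrix n n ℝ} {t : ℝ}
    (hM : ∀ i j, HasDerivAt (fun s => M s i j) (M' i j) t)
    (hdiag : ∀ i j, i ≠ j → M t i j = 0) (hM' : ∀ i, M' i i = 0) :
    HasDerivAt (fun s => (M s).det) 0 t := by
  simp only [Matrix.det_apply']
  have key (σ : Equiv.Perm n) :
      HasDerivAt (fun s => ((Equiv.Perm.sign σ : ℤ) : ℝ) * ∏ i, M s (σ i) i) 0 t := by
    have h := (HasDerivAt.fun_finsetProd (u := Finset.univ)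
      (fun i _ => hM (σ i) i)).const_mul (((Equiv.Perm.sign σ : ℤ) : ℝ))
    rwa [Finset.sum_eq_zero, mul_zero] at h
    intro i _
    by_cases hi : σ i = i
    · rw [hi, hM', smul_zero]
    · -- A permutation moving `i` also moves `σ i`, so another off-diagonal factor remains.
      have hne : σ i ≠ i := hi
      rw [Finset.prod_eq_zero (Finset.mem_erase.2 ⟨hne, Finset.mem_univ (σ i)⟩), zero_smul]
      exact hdiag _ _ fun h => hi (σ.injective h)
  simpa using HasDerivAt.fun_sum (u := Finset.univ) (fun σ _ => key σ)

namespace AlgCurvatureTensor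

variable {V : Type*} [NormedAddCommGroup V] [InnerProductSpace ℝ V]

theorem form_self_right (R : AlgCurvatureTensor V) (X Y Z : V) : R.form X Y Z Z = 0 := by
  linarith [R.skew_right X Y Z Z]

theorem form_self_left (R : AlgCurvatureTensor V) (X Y Z : V) : R.form X X Y Z = 0 := by
  linarith [R.skew_left X X Y Z]

theorem form_reverse (R : AlgCurvatureTensor V) (X Y Z W : V) :
    R.form X Y Z W = R.form W Z Y X := by
  rw [R.pair_symm, R.skew_left, R.skew_right, neg_neg]

theorem hasDerivAt_form_circle (R : AlgCurvatureTensor V) (X Z E F : V) (t : ℝ) :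
    HasDerivAt (fun s : ℝ => R.form E (Real.cos s • X + Real.sin s • Z)
        (Real.cos s • X + Real.sin s • Z) F)
      (R.form E (-Real.sin t • X + Real.cos t • Z) (Real.cos t • X + Real.sin t • Z) F +
        R.form E (Real.cos t • X + Real.sin t • Z) (-Real.sin t • X + Real.cos t • Z) F) t := by
  simp only [map_add, map_smul, LinearMap.add_apply, LinearMap.smul_apply, smul_eq_mul]
  have hc := Real.hasDerivAt_cos t
  have hs := Real.hasDerivAt_sin t
  convert! ((hc.mul ((hc.mul_const (R.form E X X F)).add (hs.mul_const (R.form E Z X F)))).add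
    (hs.mul ((hc.mul_const (R.form E X Z F)).add (hs.mul_const (R.form E Z Z F))))) using 1
  simp only [Pi.add_apply]
  ring

variable [FiniteDimensional ℝ V] {R : AlgCurvatureTensor V}

theorem jacobi_smul (R : AlgCurvatureTensor V) (c : ℝ) (X : V) :
    R.jacobi (c • X) = c ^ 2 • R.jacobi X := by
  ext Y
  refine ext_inner_right ℝ fun W => ?_
  simp only [LinearMap.smul_apply, inner_smul_left, inner_jacobi, map_smul, smul_eq_mul,
    RCLike.conj_to_real]
  ring

theorem isSymmetric_jacobi (R : AlgCurvatureTensor V) (X : V) : (R.jacobi X).IsSymmetric := by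
  intro Y Z
  rw [inner_jacobi, real_inner_comm, inner_jacobi, form_reverse]

/-! ### The duality principle -/

theorem IsJacobiOrthogonal.norm_jacobi_comm (hR : R.IsJacobiOrthogonal) {X Y : V}
    (hXY : inner ℝ X Y = 0) (hn : ‖X‖ = ‖Y‖) : ‖R.jacobi X Y‖ = ‖R.jacobi Y X‖ := by
  have h1 : R.jacobi (X + Y) (Y - X) = (2 : ℝ) • (R.jacobi X Y - R.jacobi Y X) := by
    refine ext_inner_right ℝ fun W => ?_
    simp only [inner_smul_left, inner_sub_left, inner_jacobi, map_add, map_sub,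
      LinearMap.add_apply, RCLike.conj_to_real]
    linarith [R.form_self_left X X W, R.form_self_left X Y W, R.form_self_left Y X W,
      R.form_self_left Y Y W, R.skew_left X Y X W, R.skew_left X Y Y W]
  have h2 : R.jacobi (Y - X) (X + Y) = (2 : ℝ) • (R.jacobi X Y + R.jacobi Y X) := by
    refine ext_inner_right ℝ fun W => ?_
    simp only [inner_smul_left, inner_add_left, inner_jacobi, map_add, map_sub,
      LinearMap.sub_apply, RCLike.conj_to_real]
    linarith [R.form_self_left X X W, R.form_self_left X Y W, R.form_self_left Y X W,
      R.form_self_left Y Y W, R.skew_left X Y X W, R.skew_left X Y Y W]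
  have h := hR (X + Y) (Y - X) (by
    simp only [inner_add_left, inner_sub_right, real_inner_self_eq_norm_sq, hn, hXY,
      real_inner_comm X Y]
    ring)
  rw [h1, h2, inner_smul_left, inner_smul_right, inner_sub_left, inner_add_right,
    inner_add_right, real_inner_comm (R.jacobi X Y) (R.jacobi Y X),
    real_inner_self_eq_norm_sq, real_inner_self_eq_norm_sq, RCLike.conj_to_real] at h
  exact (sq_eq_sq₀ (norm_nonneg _) (norm_nonneg _)).1 (by linarith)

/-- The duality principle for vectors of equal length. -/
theorem IsJacobiOrthogonal.jacobi_eq_smul_of_norm_eq (hR : R.IsJacobiOrthogonal) {X E : V} {μ : ℝ}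
    (hXE : inner ℝ X E = 0) (hn : ‖X‖ = ‖E‖) (hE : R.jacobi X E = μ • E) :
    R.jacobi E X = μ • X := by
  have h1 : inner ℝ (R.jacobi E X) X = μ * ‖X‖ ^ 2 := by
    rw [inner_jacobi, R.form_reverse, R.skew_left, R.skew_right, neg_neg, R.pair_symm,
      R.form_reverse, R.pair_symm, ← inner_jacobi, hE, inner_smul_left, real_inner_self_eq_norm_sq,
      hn, RCLike.conj_to_real]
  have h2 : ‖R.jacobi E X‖ ^ 2 = μ ^ 2 * ‖X‖ ^ 2 := by
    rw [← hR.norm_jacobi_comm hXE hn, hE, norm_smul, mul_pow, Real.norm_eq_abs, sq_abs, hn]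
  have h3 : ‖R.jacobi E X - μ • X‖ ^ 2 = 0 := by
    rw [norm_sub_sq_real, inner_smul_right, h1, h2, norm_smul, mul_pow, Real.norm_eq_abs, sq_abs]
    ring
  exact sub_eq_zero.1 (norm_eq_zero.1 (pow_eq_zero_iff two_ne_zero |>.1 h3))

theorem IsJacobiOrthogonal.jacobi_eq_smul (hR : R.IsJacobiOrthogonal) {X E : V} {μ : ℝ}
    (hX : ‖X‖ = 1) (hXE : inner ℝ X E = 0) (hE : R.jacobi X E = μ • E) :
    R.jacobi E X = (μ * ‖E‖ ^ 2) • X := by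
  rcases eq_or_ne E 0 with rfl | hE0
  · have := R.jacobi_smul 0 (0 : V)
    simp_all
  have h := hR.jacobi_eq_smul_of_norm_eq (X := ‖E‖ • X) (E := E) (μ := μ * ‖E‖ ^ 2)
    (by rw [inner_smul_left, hXE, mul_zero]) (by simp [norm_smul, hX])
    (by rw [jacobi_smul, LinearMap.smul_apply, hE, smul_smul, mul_comm])
  rw [map_smul, smul_comm] at h
  exact smul_right_injective V (norm_ne_zero_iff.2 hE0) h

theorem IsJacobiOrthogonal.form_eigenvector_eq_zero (hR : R.IsJacobiOrthogonal) {X Y E : V}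
    {μ : ℝ} (hX : ‖X‖ = 1) (hXY : inner ℝ X Y = 0) (hE : R.jacobi X E = μ • E) :
    R.form E X Y E = 0 := by
  -- The eigenvector need not be orthogonal to `X`: when `μ = 0` it may have a component along `X`.
  set a : ℝ := inner ℝ X E with ha
  obtain ⟨F, hF⟩ : ∃ F, F = E - a • X := ⟨_, rfl⟩
  have hXF : inner ℝ X F = 0 := by
    rw [hF, inner_sub_right, inner_smul_right, real_inner_self_eq_norm_sq, hX, ← ha]
    ring
  have hμa : μ * a = 0 := by
    have h := R.inner_jacobi X E X
    rw [form_self_right, hE, inner_smul_left, real_inner_comm] at h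
    exact h
  have hXX : R.jacobi X X = 0 := by
    refine ext_inner_right ℝ fun W => ?_
    rw [inner_jacobi, form_self_left, inner_zero_left]
  have hJF : R.jacobi X F = μ • F := by
    rw [hF, map_sub, map_smul, hXX, hE, smul_zero, sub_zero, smul_sub, smul_smul, hμa, zero_smul,
      sub_zero]
  have hFF : R.form X F F Y = 0 := by
    rw [← inner_jacobi, hR.jacobi_eq_smul hX hXF hJF, inner_smul_left, hXY, mul_zero]
  have hFX : a * R.form F X X Y = 0 := by
    rw [← inner_jacobi, hJF, inner_smul_left, RCLike.conj_to_real]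
    linear_combination inner ℝ F Y * hμa
  have hEF : E = F + a • X := by rw [hF]; abel
  rw [hEF]
  simp only [map_add, map_smul, LinearMap.add_apply, LinearMap.smul_apply, smul_eq_mul]
  rw [form_self_left, form_self_left, R.skew_right F X Y F, R.skew_right F X Y X,
    R.skew_left F X F Y]
  linear_combination hFF - hFX

/-! ### Constancy along great circles -/

theorem IsJacobiOrthogonal.hasDerivAt_det (hR : R.IsJacobiOrthogonal) {X Z : V} (hX : ‖X‖ = 1)
    (hZ : ‖Z‖ = 1) (hXZ : inner ℝ X Z = 0) (lam t : ℝ) :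
    HasDerivAt (fun s : ℝ => LinearMap.det (algebraMap ℝ (Module.End ℝ V) lam -
      R.jacobi (Real.cos s • X + Real.sin s • Z))) 0 t := by
  set P : ℝ → V := fun s => Real.cos s • X + Real.sin s • Z with hP
  set Q : V := -Real.sin t • X + Real.cos t • Z with hQ
  have hXX : inner ℝ X X = (1 : ℝ) := by rw [real_inner_self_eq_norm_sq, hX, one_pow]
  have hZZ : inner ℝ Z Z = (1 : ℝ) := by rw [real_inner_self_eq_norm_sq, hZ, one_pow]
  have hZX : inner ℝ Z X = (0 : ℝ) := by rw [real_inner_comm, hXZ]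
  have hPt : ‖P t‖ = 1 := by
    rw [← sq_eq_sq₀ (norm_nonneg _) zero_le_one, ← real_inner_self_eq_norm_sq]
    simp only [hP, inner_add_left, inner_add_right, inner_smul_left, inner_smul_right, hXX, hZZ,
      hXZ, hZX, RCLike.conj_to_real]
    linarith [Real.sin_sq_add_cos_sq t]
  have hPQ : inner ℝ (P t) Q = 0 := by
    simp only [hP, hQ, inner_add_left, inner_add_right, inner_smul_left, inner_smul_right, hXX,
      hZZ, hXZ, hZX, RCLike.conj_to_real]
    ring
  let b := (R.isSymmetric_jacobi (P t)).eigenvectorBasis rfl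
  have hb (i) : R.jacobi (P t) (b i) =
      (R.isSymmetric_jacobi (P t)).eigenvalues rfl i • b i :=
    (R.isSymmetric_jacobi (P t)).apply_eigenvectorBasis rfl i
  have hentry (s : ℝ) (i j) : LinearMap.toMatrix b.toBasis b.toBasis
      (algebraMap ℝ (Module.End ℝ V) lam - R.jacobi (P s)) i j =
      lam * inner ℝ (b i) (b j) - R.form (b j) (P s) (P s) (b i) := by
    rw [LinearMap.toMatrix_apply, OrthonormalBasis.coe_toBasis,
      OrthonormalBasis.coe_toBasis_repr_apply, OrthonormalBasis.repr_apply_apply,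
      LinearMap.sub_apply, Module.algebraMap_end_apply, inner_sub_right, inner_smul_right,
      real_inner_comm (R.jacobi _ _), inner_jacobi]
  simp only [← LinearMap.det_toMatrix b.toBasis]
  refine hasDerivAt_det_of_diagonal
    (M' := fun i j => -(R.form (b j) Q (P t) (b i) + R.form (b j) (P t) Q (b i))) ?_ ?_ ?_
  · intro i j
    exact ((R.hasDerivAt_form_circle X Z (b j) (b i) t).const_sub _).congr_of_eventuallyEq
      (Filter.Eventually.of_forall fun s => hentry s i j)
  · intro i j hij
    rw [hentry, ← inner_jacobi, hb, inner_smul_left, b.orthonormal.2 hij,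
      b.orthonormal.2 hij.symm]
    simp
  · intro i
    rw [R.form_reverse (b i) Q, hR.form_eigenvector_eq_zero hPt hPQ (hb i)]
    simp

theorem IsJacobiOrthogonal.det_sub_jacobi_eq (hR : R.IsJacobiOrthogonal) {X Y : V} (hX : ‖X‖ = 1)
    (hY : ‖Y‖ = 1) (lam : ℝ) :
    LinearMap.det (algebraMap ℝ (Module.End ℝ V) lam - R.jacobi X) =
      LinearMap.det (algebraMap ℝ (Module.End ℝ V) lam - R.jacobi Y) := by
  set c : ℝ := inner ℝ X Y with hc
  set W : V := Y - c • X with hW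
  have hYW : Y = c • X + W := by rw [hW]; abel
  have hXW : inner ℝ X W = 0 := by
    rw [hW, inner_sub_right, inner_smul_right, real_inner_self_eq_norm_sq, hX, ← hc]
    ring
  have hcW : c ^ 2 + ‖W‖ ^ 2 = 1 := by
    have h : ‖c • X + W‖ ^ 2 = 1 := by rw [← hYW, hY, one_pow]
    rw [norm_add_sq_real, inner_smul_left, hXW, norm_smul, hX, mul_one, Real.norm_eq_abs,
      sq_abs] at h
    linarith
  by_cases hW0 : W = 0
  · have hc1 : c ^ 2 = 1 := by simpa [hW0] using hcW
    rw [hYW, hW0, add_zero, jacobi_smul, hc1, one_smul]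
  · have hWn : ‖W‖ ≠ 0 := norm_ne_zero_iff.2 hW0
    have hcos : Real.cos (Real.arccos c) = c :=
      Real.cos_arccos (by nlinarith [sq_nonneg ‖W‖]) (by nlinarith [sq_nonneg ‖W‖])
    have hsin : Real.sin (Real.arccos c) = ‖W‖ := by
      rw [Real.sin_arccos, show 1 - c ^ 2 = ‖W‖ ^ 2 by linarith, Real.sqrt_sq (norm_nonneg _)]
    have hd := hR.hasDerivAt_det (Z := ‖W‖⁻¹ • W) hX
      (by rw [norm_smul, norm_inv, norm_norm, inv_mul_cancel₀ hWn])
      (by rw [inner_smul_right, hXW, mul_zero]) lam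
    have h := is_const_of_deriv_eq_zero (fun t => (hd t).differentiableAt)
      (fun t => (hd t).deriv) 0 (Real.arccos c)
    simpa [hcos, hsin, smul_smul, hWn, ← hYW] using h

/-! ### Passing to the reduced Jacobi operator -/

theorem det_sub_jacobi (R : AlgCurvatureTensor V) {X : V} (hX : X ≠ 0) (lam : ℝ) :
    LinearMap.det (algebraMap ℝ (Module.End ℝ V) lam - R.jacobi X) =
      (R.reducedJacobi X).charpoly.eval lam * lam := by
  have he : (Submodule.span ℝ {X})ᗮ ≤ (Submodule.span ℝ {X})ᗮ.comap
      (algebraMap ℝ (Module.End ℝ V) lam - R.jacobi X) := fun Y hY =>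
    Submodule.sub_mem _ (Submodule.smul_mem _ lam hY) (R.jacobi_mem_orthogonal X Y)
  have hrest : (algebraMap ℝ (Module.End ℝ V) lam - R.jacobi X).restrict he =
      algebraMap ℝ (Module.End ℝ (Submodule.span ℝ {X})ᗮ) lam - R.reducedJacobi X := by
    ext Y
    rfl
  -- The range of `𝓙_X` lies in `X^⊥`, so only the scalar `lam` survives on the quotient.
  have hquot : (Submodule.span ℝ {X})ᗮ.mapQ (Submodule.span ℝ {X})ᗮ
      (algebraMap ℝ (Module.End ℝ V) lam - R.jacobi X) he = lam • LinearMap.id := by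
    ext Y
    have h0 : (Submodule.span ℝ {X})ᗮ.mkQ (R.jacobi X Y) = 0 :=
      (Submodule.Quotient.mk_eq_zero _).2 (R.jacobi_mem_orthogonal X Y)
    change (Submodule.span ℝ {X})ᗮ.mkQ (lam • Y - R.jacobi X Y) =
      lam • (Submodule.span ℝ {X})ᗮ.mkQ Y
    rw [map_sub, h0, sub_zero, map_smul]
  have hfin : Module.finrank ℝ (V ⧸ (Submodule.span ℝ {X})ᗮ) = 1 := by
    have h1 := (Submodule.span ℝ {X})ᗮ.finrank_quotient_add_finrank
    have h2 := (Submodule.span ℝ {X}).finrank_add_finrank_orthogonal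
    rw [finrank_span_singleton hX] at h2
    omega
  rw [LinearMap.det_eq_det_mul_det (Submodule.span ℝ {X})ᗮ _ he, hrest, hquot,
    LinearMap.det_smul, hfin, LinearMap.det_id, LinearMap.eval_charpoly, pow_one, mul_one]

end AlgCurvatureTensor

theorem corollary3p2 {V : Type*} [NormedAddCommGroup V] [InnerProductSpace ℝ V]
    [FiniteDimensional ℝ V] (R : AlgCurvatureTensor V) (hR : R.IsJacobiOrthogonal) :
    R.IsOsserman := by
  intro X Y hX hY
  refine Polynomial.eq_of_infinite_eval_eq _ _
    ((Set.finite_singleton (0 : ℝ)).infinite_compl.mono fun lam hlam => ?_)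
  have h := hR.det_sub_jacobi_eq hX hY lam
  rw [R.det_sub_jacobi (norm_ne_zero_iff.1 (by simp [hX])),
    R.det_sub_jacobi (norm_ne_zero_iff.1 (by simp [hY]))] at h
  exact mul_right_cancel₀ hlam h
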